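/- Let $\mathcal H$ be a complex Hilbert space of finite dimension $n$, and let $\rho$ and $\sigma$ be states (density operators, i.e. positive operators of trace $1$) on $\mathcal H$. For a state $\rho$ with eigenvalues $\lambda_1\ge\dots\ge\lambda_n\ge 0$ (listed with multiplicity), the subentropy is $$Q(\rho)=-\sum_{i=1}^n\frac{\lambda_i^n}{\prod_{j\neq i}(\lambda_i-\lambda_j)}\,\ln\lambda_i ,$$ understood, when eigenvalues coincide or vanish, as the limit of this expression evaluated at vectors with pairwise distinct positive entries tending to $(\lambda_1,\dots,\lambda_n)$. Let $\|A\|_1$ denote the trace norm (the sum of the singular values of $A$), and suppose that the trace distance $T=\tfrac12\|\rho-\sigma\|_1$ satisfies $T\le \frac{1}{2e}$. Then the limits defining $Q(\rho)$ and $Q(\sigma)$ exist and are finite, and $$|Q(\rho)-Q(\sigma)|\le 2T\ln n+\eta(2T),\qquad \eta(y)=-y\ln y ,$$ and also $$|Q(\rho)-Q(\sigma)|\le T\ln(n-1)+h(T),\qquad h(T)=-T\ln T-(1-T)\ln(1-T),$$ with the convention $0\ln 0=0$ throughout (so that for $n=1$, where $T=0$, both right-hand sides are $0$). -/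

import Mathlib

open Filter Topology Module

noncomputable section

/-- A state (density operator) on a complex Hilbert space: a positive operator of unit trace. -/
structure QState (H : Type*) [NormedAddCommGroup H] [InnerProductSpace ℂ H] where
  /-- The underlying operator. -/
  op : H →ₗ[ℂ] H
  pos : op.IsPositive
  trace_eq_one : LinearMap.trace ℂ H op = 1

/-- The expression `- ∑ i, (x i ^ n / ∏_{j ≠ i} (x i - x j)) * ln (x i)`, which is meaningful for
pairwise distinct positive `x i`. -/
def subentropyExpr {n : ℕ} (x : Fin n → ℝ) : ℝ :=
  -∑ i, x i ^ n / (∏ j ∈ Finset.univ.erase i, (x i - x j)) * Real.log (x i)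

/-- The vectors at which `subentropyExpr` is meaningful: all entries are positive and pairwise
distinct. -/
def genericVectors (n : ℕ) : Set (Fin n → ℝ) :=
  {x | (∀ i, 0 < x i) ∧ Function.Injective x}

/-- The function `F` of the eigenvalue vector: the limit of `subentropyExpr` along vectors with
pairwise distinct positive entries. -/
def subentropyFun {n : ℕ} (x : Fin n → ℝ) : ℝ :=
  limUnder (𝓝[genericVectors n] x) subentropyExpr

section

variable {H : Type*} [NormedAddCommGroup H] [InnerProductSpace ℂ H] [FiniteDimensional ℂ H]

/-- The eigenvalues of a state, with multiplicity, in non-increasing order. -/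
def QState.eigenvalues (ρ : QState H) : Fin (finrank ℂ H) → ℝ :=
  ρ.pos.isSymmetric.eigenvalues rfl

/-- The subentropy of a state. -/
def subentropy (ρ : QState H) : ℝ :=
  subentropyFun ρ.eigenvalues

/-- The trace norm of an operator: the sum of its singular values. -/
def traceNorm (A : H →ₗ[ℂ] H) : ℝ :=
  ∑ i ∈ Finset.range (finrank ℂ H), A.singularValues i

/-- The trace distance of two states. -/
def traceDist (ρ σ : QState H) : ℝ :=
  1 / 2 * traceNorm (ρ.op - σ.op)

end

/-- A nonnegative non-increasing vector is a limit of vectors with pairwise distinct positive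
entries, so that a limit along such vectors is unique. -/
theorem neBot_nhdsWithin_genericVectors {n : ℕ} {x : Fin n → ℝ} (h0 : ∀ i, 0 ≤ x i)
    (hx : Antitone x) : (𝓝[genericVectors n] x).NeBot := by
  let y : ℝ → Fin n → ℝ := fun t i => x i + t * ((n : ℝ) - (i : ℕ))
  have hy : Tendsto y (𝓝[>] 0) (𝓝 x) := by
    have hc : Continuous y := by fun_prop
    have h := hc.tendsto 0
    have e : y 0 = x := by funext i; simp [y]
    rw [e] at h
    exact h.mono_left nhdsWithin_le_nhds
  refine (tendsto_nhdsWithin_iff.2 ⟨hy, ?_⟩).neBot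
  filter_upwards [self_mem_nhdsWithin] with t ht
  have ht : 0 < t := ht
  have hi : ∀ i : Fin n, (0 : ℝ) < (n : ℝ) - (i : ℕ) := fun i => by
    have : ((i : ℕ) : ℝ) < n := by exact_mod_cast i.2
    linarith
  refine ⟨fun i => add_pos_of_nonneg_of_pos (h0 i) (mul_pos ht (hi i)), ?_⟩
  have hs : StrictAnti (y t) := by
    intro i j hij
    have h1 : x j ≤ x i := hx hij.le
    have h2 : ((i : ℕ) : ℝ) < (j : ℕ) := by exact_mod_cast hij
    have h3 : t * ((n : ℝ) - (j : ℕ)) < t * ((n : ℝ) - (i : ℕ)) :=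
      mul_lt_mul_of_pos_left (by linarith) ht
    show x j + t * ((n : ℝ) - (j : ℕ)) < x i + t * ((n : ℝ) - (i : ℕ))
    linarith
  exact hs.injective

/-- On vectors with pairwise distinct positive entries the limit is the expression itself. -/
theorem subentropyFun_eq {n : ℕ} {x : Fin n → ℝ} (hx : x ∈ genericVectors n) :
    subentropyFun x = subentropyExpr x := by
  have hne : (𝓝[genericVectors n] x).NeBot :=
    mem_closure_iff_nhdsWithin_neBot.1 (subset_closure hx)
  refine Tendsto.limUnder_eq ?_
  have hc : ContinuousAt (subentropyExpr (n := n)) x := by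
    unfold subentropyExpr
    refine ContinuousAt.neg (tendsto_finsetSum _ fun i _ => ?_)
    refine ContinuousAt.mul (ContinuousAt.div (Continuous.continuousAt (by fun_prop))
      (Continuous.continuousAt (by fun_prop)) ?_)
      (ContinuousAt.log (continuous_apply i).continuousAt (hx.1 i).ne')
    refine Finset.prod_ne_zero_iff.2 fun j hj => sub_ne_zero.2 fun h => ?_
    exact (Finset.ne_of_mem_erase hj) (hx.2 h).symm
  exact hc.tendsto.mono_left nhdsWithin_le_nhds

end

/-! On generic vectors Lagrange interpolation gives `subentropyExpr x` = ∫₀^∞ (1 - ∏ s/(s+x_i) - (∑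
x_i)/(1+s)) ds. The right side is continuous on the closed orthant, so the limits exist there
(`tendsto_subentropyExpr`). Call the integral Q and put η(c) = -c ln c. Pointwise estimates of the
integrand show that Q is subadditive, concave, at most the entropy ∑ η(x_i), and nonnegative on
probability vectors; rescaling s gives Q(cx) = c Q(x) + (∑ x_i) η(c). For probability vectors x, y
at ℓ¹ distance 2t, let z = min(x, y), x = z + a, y = z + b. Then Q(x) ≤ Q(z) + Q(a). The part a has
mass t and a zero entry, so Q(a) ≤ t ln(n-1) + η(t); concavity along y = z + b gives Q(z) ≤ Q(y) +
η(1-t). Together these give t ln(n-1) + h(t) (`subentropyIntegral_sub_le`). Ordered spectra satisfy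
t ≤ T by Weyl monotonicity (`sum_abs_eigenvalues_sub_le`), and h increases on [0, 1/2]. For n ≥ 2
the first bound follows from this one. -/

/-! ### Spectra of nearby states -/

open scoped InnerProductSpace in
/-- The quadratic form of a symmetric operator in terms of its eigenvalues. -/
theorem LinearMap.IsSymmetric.re_inner_apply_self_eq_sum {H : Type*} [NormedAddCommGroup H]
    [InnerProductSpace ℂ H] [FiniteDimensional ℂ H] {n : ℕ} (hn : finrank ℂ H = n)
    {A : H →ₗ[ℂ] H} (hA : A.IsSymmetric) (x : H) :
    (⟪A x, x⟫_ℂ).re = ∑ i, hA.eigenvalues hn i * ‖⟪hA.eigenvectorBasis hn i, x⟫_ℂ‖ ^ 2 := by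
  rw [← (hA.eigenvectorBasis hn).sum_inner_mul_inner (A x) x, Complex.re_sum]
  refine Finset.sum_congr rfl fun i _ => ?_
  have h := hA x (hA.eigenvectorBasis hn i)
  rw [hA.apply_eigenvectorBasis, inner_smul_right] at h
  rw [h, ← inner_conj_symm x, mul_assoc, ← Complex.normSq_eq_conj_mul_self,
    ← Complex.normSq_eq_norm_sq]
  simp [-Complex.ofReal_mul, ← Complex.ofReal_mul]

open scoped InnerProductSpace in
/-- Weyl's monotonicity principle: the ordered eigenvalues are monotone in the operator. -/
theorem LinearMap.IsSymmetric.eigenvalues_le_eigenvalues {H : Type*} [NormedAddCommGroup H]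
    [InnerProductSpace ℂ H] [FiniteDimensional ℂ H] {n : ℕ} (hn : finrank ℂ H = n)
    {A B : H →ₗ[ℂ] H} (hA : A.IsSymmetric) (hB : B.IsSymmetric)
    (hAB : ∀ x, (⟪A x, x⟫_ℂ).re ≤ (⟪B x, x⟫_ℂ).re) (i : Fin n) :
    hA.eigenvalues hn i ≤ hB.eigenvalues hn i := by
  -- The (n-1-i) + i = n-1 linear conditions leave a nonzero vector orthogonal to the later
  -- eigenvectors of A and the earlier ones of B; its two Rayleigh quotients separate the i-th
  -- eigenvalues.
  let f : H →ₗ[ℂ] ({j : Fin n // i < j} → ℂ) × ({j : Fin n // j < i} → ℂ) :=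
    (LinearMap.pi fun j : {j : Fin n // i < j} =>
        (innerSL ℂ (hA.eigenvectorBasis hn j)).toLinearMap).prod
      (LinearMap.pi fun j : {j : Fin n // j < i} =>
        (innerSL ℂ (hB.eigenvectorBasis hn j)).toLinearMap)
  have hf : LinearMap.ker f ≠ ⊥ := by
    refine LinearMap.ker_ne_bot_of_finrank_lt ?_
    have h1 : Fintype.card {j : Fin n // i < j} = n - 1 - i := by
      rw [Fintype.card_subtype, Finset.filter_lt_eq_Ioi, Fin.card_Ioi]
    have h2 : Fintype.card {j : Fin n // j < i} = i := by
      rw [Fintype.card_subtype, Finset.filter_gt_eq_Iio, Fin.card_Iio]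
    rw [finrank_prod, finrank_fintype_fun_eq_card, finrank_fintype_fun_eq_card, h1, h2, hn]
    omega
  obtain ⟨x, hx, hx0⟩ := (Submodule.ne_bot_iff _).1 hf
  rw [LinearMap.mem_ker, Prod.ext_iff] at hx
  have hxA : ∀ j, i < j → ⟪hA.eigenvectorBasis hn j, x⟫_ℂ = 0 := fun j hj =>
    congrFun hx.1 ⟨j, hj⟩
  have hxB : ∀ j, j < i → ⟪hB.eigenvectorBasis hn j, x⟫_ℂ = 0 := fun j hj =>
    congrFun hx.2 ⟨j, hj⟩
  have hA' : hA.eigenvalues hn i * ‖x‖ ^ 2 ≤ (⟪A x, x⟫_ℂ).re := by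
    rw [hA.re_inner_apply_self_eq_sum hn, ← (hA.eigenvectorBasis hn).sum_sq_norm_inner_right x,
      Finset.mul_sum]
    refine Finset.sum_le_sum fun j _ => ?_
    rcases lt_or_ge i j with h | h
    · simp [hxA j h]
    · exact mul_le_mul_of_nonneg_right (hA.eigenvalues_antitone hn h) (by positivity)
  have hB' : (⟪B x, x⟫_ℂ).re ≤ hB.eigenvalues hn i * ‖x‖ ^ 2 := by
    rw [hB.re_inner_apply_self_eq_sum hn, ← (hB.eigenvectorBasis hn).sum_sq_norm_inner_right x,
      Finset.mul_sum]
    refine Finset.sum_le_sum fun j _ => ?_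
    rcases lt_or_ge j i with h | h
    · simp [hxB j h]
    · exact mul_le_mul_of_nonneg_right (hB.eigenvalues_antitone hn h) (by positivity)
  exact le_of_mul_le_mul_right (hA'.trans ((hAB x).trans hB'))
    (by have := norm_pos_iff.2 hx0; positivity)

open scoped InnerProductSpace in
/-- The absolute eigenvalues of a symmetric operator sum to at most its trace norm. -/
theorem sum_abs_eigenvalues_le_traceNorm {H : Type*} [NormedAddCommGroup H]
    [InnerProductSpace ℂ H] [FiniteDimensional ℂ H] {A : H →ₗ[ℂ] H} (hA : A.IsSymmetric) :
    ∑ i, |hA.eigenvalues rfl i| ≤ traceNorm A := by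
  set v := hA.eigenvectorBasis rfl with hv
  set w := A.isSymmetric_adjoint_comp_self.eigenvectorBasis rfl with hw
  -- The weights ‖⟪v i, w j⟫‖² are doubly stochastic and the j-th singular value is the quadratic
  -- mean of |λ_i| under them, hence at least the arithmetic mean.
  have hs : ∀ j : Fin (finrank ℂ H),
      ∑ i, |hA.eigenvalues rfl i| * ‖⟪v i, w j⟫_ℂ‖ ^ 2 ≤ A.singularValues j := by
    intro j
    have hsq : A.singularValues j ^ 2 = ∑ i, |hA.eigenvalues rfl i| ^ 2 * ‖⟪v i, w j⟫_ℂ‖ ^ 2 := by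
      have h1 : A.singularValues j ^ 2 = ‖A (w j)‖ ^ 2 := by
        rw [A.sq_singularValues_fin rfl, ← inner_self_eq_norm_sq (𝕜 := ℂ),
          ← LinearMap.adjoint_inner_right]
        have := A.isSymmetric_adjoint_comp_self.apply_eigenvectorBasis rfl j
        rw [LinearMap.comp_apply] at this
        rw [← hw] at this
        rw [this, inner_smul_right]
        simp
      rw [h1, ← v.sum_sq_norm_inner_right]
      refine Finset.sum_congr rfl fun i _ => ?_
      rw [← hA, hA.apply_eigenvectorBasis, inner_smul_left, norm_mul, mul_pow]
      simp [hv]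
    refine le_of_sq_le_sq ?_ (A.singularValues_nonneg j)
    have hcs := Finset.sum_mul_sq_le_sq_mul_sq Finset.univ
      (fun i => |hA.eigenvalues rfl i| * ‖⟪v i, w j⟫_ℂ‖) (fun i => ‖⟪v i, w j⟫_ℂ‖)
    rw [v.sum_sq_norm_inner_right, w.norm_eq_one] at hcs
    rw [hsq]
    simpa only [mul_pow, mul_assoc, ← pow_two, one_pow, mul_one] using hcs
  calc ∑ i, |hA.eigenvalues rfl i|
      = ∑ i, ∑ j, |hA.eigenvalues rfl i| * ‖⟪v i, w j⟫_ℂ‖ ^ 2 := by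
        refine Finset.sum_congr rfl fun i _ => ?_
        rw [← Finset.mul_sum, w.sum_sq_norm_inner_left, v.norm_eq_one]
        simp
    _ = ∑ j, ∑ i, |hA.eigenvalues rfl i| * ‖⟪v i, w j⟫_ℂ‖ ^ 2 := Finset.sum_comm
    _ ≤ ∑ j : Fin (finrank ℂ H), A.singularValues j := Finset.sum_le_sum fun j _ => hs j
    _ = traceNorm A := by rw [traceNorm, Finset.sum_range]

open scoped InnerProductSpace in
/-- The positive part of a symmetric operator. -/
theorem LinearMap.IsSymmetric.exists_posPart {H : Type*} [NormedAddCommGroup H]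
    [InnerProductSpace ℂ H] [FiniteDimensional ℂ H] {A : H →ₗ[ℂ] H} (hA : A.IsSymmetric) :
    ∃ P : H →ₗ[ℂ] H, P.IsPositive ∧ (∀ x, (⟪A x, x⟫_ℂ).re ≤ (⟪P x, x⟫_ℂ).re) ∧
      (LinearMap.trace ℂ H P).re = ∑ i, max (hA.eigenvalues rfl i) 0 := by
  set v := hA.eigenvectorBasis rfl with hv
  let P : H →ₗ[ℂ] H := ∑ i, ((max (hA.eigenvalues rfl i) 0 : ℝ) : ℂ) •
    (InnerProductSpace.rankOne ℂ (v i) (v i)).toLinearMap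
  have hP : ∀ x, (⟪P x, x⟫_ℂ).re = ∑ i, max (hA.eigenvalues rfl i) 0 * ‖⟪v i, x⟫_ℂ‖ ^ 2 := by
    intro x
    simp only [P, LinearMap.sum_apply, sum_inner, Complex.re_sum]
    refine Finset.sum_congr rfl fun i _ => ?_
    rw [LinearMap.smul_apply, inner_smul_left, Complex.conj_ofReal, Complex.re_ofReal_mul]
    congr 1
    rw [ContinuousLinearMap.coe_coe, InnerProductSpace.rankOne_apply, inner_smul_left,
      ← Complex.normSq_eq_conj_mul_self, Complex.ofReal_re, Complex.normSq_eq_norm_sq]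
  refine ⟨P, ⟨?_, fun x => ?_⟩, fun x => ?_, ?_⟩
  · intro x y
    simp only [P, LinearMap.sum_apply, sum_inner, inner_sum]
    refine Finset.sum_congr rfl fun i _ => ?_
    simp only [LinearMap.smul_apply, ContinuousLinearMap.coe_coe, InnerProductSpace.rankOne_apply,
      inner_smul_left, inner_smul_right, Complex.conj_ofReal, inner_conj_symm]
    ring
  · show 0 ≤ (⟪P x, x⟫_ℂ).re
    rw [hP]
    exact Finset.sum_nonneg fun i _ => mul_nonneg (le_max_right _ _) (by positivity)
  · rw [hP, hA.re_inner_apply_self_eq_sum rfl]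
    exact Finset.sum_le_sum fun i _ => mul_le_mul_of_nonneg_right (le_max_left _ _) (by positivity)
  · simp [P, InnerProductSpace.trace_rankOne]

theorem QState.eigenvalues_nonneg {H : Type*} [NormedAddCommGroup H] [InnerProductSpace ℂ H]
    [FiniteDimensional ℂ H] (ρ : QState H) (i : Fin (finrank ℂ H)) : 0 ≤ ρ.eigenvalues i :=
  ρ.pos.nonneg_eigenvalues rfl i

theorem QState.sum_eigenvalues {H : Type*} [NormedAddCommGroup H] [InnerProductSpace ℂ H]
    [FiniteDimensional ℂ H] (ρ : QState H) : ∑ i, ρ.eigenvalues i = 1 := by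
  have h := ρ.pos.isSymmetric.re_trace_eq_sum_eigenvalues rfl
  rw [ρ.trace_eq_one] at h
  exact h.symm.trans (by simp)

/-- The ordered eigenvalue vectors of two states are at most as far apart as the states. -/
theorem sum_abs_eigenvalues_sub_le {H : Type*} [NormedAddCommGroup H] [InnerProductSpace ℂ H]
    [FiniteDimensional ℂ H] (ρ σ : QState H) :
    ∑ i, |ρ.eigenvalues i - σ.eigenvalues i| ≤ 2 * traceDist ρ σ := by
  have hD : (ρ.op - σ.op).IsSymmetric := ρ.pos.isSymmetric.sub σ.pos.isSymmetric
  -- V = σ + P dominates both ρ and σ, so its ordered eigenvalues dominate both spectra, and the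
  -- excess masses add up to 2 tr P.
  obtain ⟨P, hP, hle, htr⟩ := hD.exists_posPart
  have hV : (σ.op + P).IsSymmetric := σ.pos.isSymmetric.add hP.isSymmetric
  have hsumD : ∑ i, hD.eigenvalues rfl i = 0 := by
    have h := hD.re_trace_eq_sum_eigenvalues rfl
    rw [map_sub, ρ.trace_eq_one, σ.trace_eq_one] at h
    simpa using h.symm
  have hsumV : ∑ i, hV.eigenvalues rfl i = 1 + ∑ i, max (hD.eigenvalues rfl i) 0 := by
    have h := hV.re_trace_eq_sum_eigenvalues rfl
    rw [map_add, σ.trace_eq_one] at h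
    rw [← h, ← htr]
    simp
  have hρV : ∀ i, ρ.eigenvalues i ≤ hV.eigenvalues rfl i := by
    refine ρ.pos.isSymmetric.eigenvalues_le_eigenvalues rfl hV fun x => ?_
    have := hle x
    simp only [LinearMap.sub_apply, LinearMap.add_apply, inner_sub_left, inner_add_left,
      Complex.sub_re, Complex.add_re] at this ⊢
    linarith
  have hσV : ∀ i, σ.eigenvalues i ≤ hV.eigenvalues rfl i := by
    refine σ.pos.isSymmetric.eigenvalues_le_eigenvalues rfl hV fun x => ?_
    have := hP.2 x
    simp only [LinearMap.add_apply, inner_add_left, Complex.add_re]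
    exact le_add_of_nonneg_right this
  have h1 : ∑ i, |ρ.eigenvalues i - σ.eigenvalues i| ≤
      ∑ i, (2 * hV.eigenvalues rfl i - ρ.eigenvalues i - σ.eigenvalues i) := by
    refine Finset.sum_le_sum fun i _ => abs_le.2 ⟨?_, ?_⟩ <;> linarith [hρV i, hσV i]
  have h2 : 2 * ∑ i, max (hD.eigenvalues rfl i) 0 = ∑ i, |hD.eigenvalues rfl i| := by
    rw [← sub_eq_zero, Finset.mul_sum, ← Finset.sum_sub_distrib]
    refine Eq.trans ?_ hsumD
    refine Finset.sum_congr rfl fun i _ => ?_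
    rcases le_total 0 (hD.eigenvalues rfl i) with h | h
    · rw [max_eq_left h, abs_of_nonneg h]; ring
    · rw [max_eq_right h, abs_of_nonpos h]; ring
  have h3 := sum_abs_eigenvalues_le_traceNorm hD
  rw [Finset.sum_sub_distrib, Finset.sum_sub_distrib, ← Finset.mul_sum, hsumV,
    ρ.sum_eigenvalues, σ.sum_eigenvalues] at h1
  rw [traceDist]
  linarith

/-! ### Integral representation and dominated convergence -/

section

open MeasureTheory Set

/-- The integrand of the integral representation of the subentropy. -/
noncomputable def subentropyIntegrand {n : ℕ} (x : Fin n → ℝ) (s : ℝ) : ℝ :=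
  1 - ∏ i, s / (s + x i) - (∑ i, x i) / (1 + s)

/-- The integral representation of the subentropy, meaningful on the nonnegative orthant. -/
noncomputable def subentropyIntegral {n : ℕ} (x : Fin n → ℝ) : ℝ :=
  ∫ s in Ioi (0 : ℝ), subentropyIntegrand x s

theorem prod_div_add_nonneg {n : ℕ} {x : Fin n → ℝ} (hx : ∀ i, 0 ≤ x i) {s : ℝ} (hs : 0 < s) :
    0 ≤ ∏ i, s / (s + x i) :=
  Finset.prod_nonneg fun i _ => by have := hx i; positivity

theorem prod_div_add_le_one {n : ℕ} {x : Fin n → ℝ} (hx : ∀ i, 0 ≤ x i) {s : ℝ} (hs : 0 < s) :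
    ∏ i, s / (s + x i) ≤ 1 :=
  Finset.prod_le_one (fun i _ => by have := hx i; positivity) fun i _ => by
    have := hx i
    rw [div_le_one (by positivity)]
    linarith

/-- Expanding ∏ (s + x_i) and keeping only the two lowest orders in x gives s^(n-1) (s + ∑ x_i). -/
theorem prod_div_add_le {n : ℕ} {x : Fin n → ℝ} (hx : ∀ i, 0 ≤ x i) {s : ℝ} (hs : 0 < s) :
    ∏ i, s / (s + x i) ≤ s / (s + ∑ i, x i) := by
  induction n with
  | zero => simp [hs.ne']
  | succ n ih =>
    have h0 := hx 0
    have h1 : 0 ≤ ∑ i : Fin n, x i.succ := Finset.sum_nonneg fun i _ => hx _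
    rw [Fin.prod_univ_succ, Fin.sum_univ_succ]
    refine (mul_le_mul_of_nonneg_left (ih fun i => hx i.succ) (by positivity)).trans ?_
    rw [div_mul_div_comm, div_le_div_iff₀ (by positivity) (by positivity)]
    nlinarith [mul_nonneg (mul_nonneg hs.le h0) h1]

/-- This is the union bound 1 - ∏ (1 - p_i) ≤ ∑ p_i with p_i = x_i/(s + x_i). -/
theorem one_sub_sum_le_prod_div_add {n : ℕ} {x : Fin n → ℝ} (hx : ∀ i, 0 ≤ x i) {s : ℝ}
    (hs : 0 < s) : 1 - ∑ i, x i / (s + x i) ≤ ∏ i, s / (s + x i) := by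
  induction n with
  | zero => simp
  | succ n ih =>
    have h0 := hx 0
    have h1 := prod_div_add_le_one (fun i : Fin n => hx i.succ) hs
    have h2 := ih fun i => hx i.succ
    have h3 : s / (s + x 0) = 1 - x 0 / (s + x 0) := by field_simp; ring
    have h4 : 0 ≤ x 0 / (s + x 0) := by positivity
    rw [Fin.prod_univ_succ, Fin.sum_univ_succ, h3]
    nlinarith

theorem abs_div_add_sub_div_le {c M : ℝ} (hc : 0 ≤ c) (hcM : c ≤ M) (hM : 1 ≤ M) {s : ℝ}
    (hs : 0 < s) : |c / (s + c) - c / (1 + s)| ≤ (1 + M) * M * (1 / (1 + s) ^ 2) := by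
  have e : c / (s + c) - c / (1 + s) = c / (s + c) * (1 - c) * (1 / (1 + s)) := by
    field_simp; ring
  have h1 : c / (s + c) ≤ M * (1 / (1 + s)) := by
    rw [mul_one_div, div_le_div_iff₀ (by positivity) (by positivity)]
    nlinarith [mul_nonneg hc (sub_nonneg.2 hM)]
  have h2 : |1 - c| ≤ 1 + M := abs_le.2 ⟨by linarith, by linarith⟩
  have h3 : 0 ≤ c / (s + c) := by positivity
  have h4 : 0 ≤ 1 / (1 + s) := by positivity
  rw [e, abs_mul, abs_mul, abs_of_nonneg h3, abs_of_nonneg h4]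
  calc c / (s + c) * |1 - c| * (1 / (1 + s))
      ≤ (M * (1 / (1 + s))) * (1 + M) * (1 / (1 + s)) := by gcongr
    _ = (1 + M) * M * (1 / (1 + s) ^ 2) := by field_simp

theorem integrableOn_one_div_one_add_sq :
    IntegrableOn (fun s : ℝ => 1 / (1 + s) ^ 2) (Ioi 0) := by
  refine integrableOn_Ioi_deriv_of_nonneg' (g := fun s : ℝ => -(1 + s)⁻¹) (l := -0) ?_ ?_ ?_
  · intro s hs
    have hs : 0 ≤ s := hs
    have := (((hasDerivAt_id s).const_add 1).inv (by simp; positivity)).neg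
    convert! this using 1
    simp [neg_div]
  · intro s _; positivity
  · exact (tendsto_inv_atTop_zero.comp (tendsto_atTop_add_const_left _ 1 tendsto_id)).neg

theorem integrableOn_div_add_sub_div {c : ℝ} (hc : 0 ≤ c) :
    IntegrableOn (fun s : ℝ => c / (s + c) - c / (1 + s)) (Ioi 0) := by
  refine Integrable.mono' (integrableOn_one_div_one_add_sq.const_mul ((1 + (1 + c)) * (1 + c)))
    (Measurable.aestronglyMeasurable (by fun_prop)) ?_
  refine (ae_restrict_mem measurableSet_Ioi).mono fun s hs => ?_
  exact abs_div_add_sub_div_le hc (by linarith) (by linarith) hs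

/-- The antiderivative c (ln(s+c) - ln(1+s)) vanishes at infinity and equals c ln c at 0. -/
theorem integral_div_add_sub_div {c : ℝ} (hc : 0 ≤ c) :
    ∫ s in Ioi (0 : ℝ), (c / (s + c) - c / (1 + s)) = Real.negMulLog c := by
  rcases hc.eq_or_lt with rfl | hc
  · simp
  have h := integral_Ioi_of_hasDerivAt_of_tendsto' (a := 0) (m := c * 0)
    (f := fun s : ℝ => c * (Real.log (s + c) - Real.log (1 + s)))
    (f' := fun s : ℝ => c / (s + c) - c / (1 + s)) ?_ (integrableOn_div_add_sub_div hc.le) ?_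
  · rw [h]; simp [Real.negMulLog]
  · intro s hs
    have hs : 0 ≤ s := hs
    have h1 := ((hasDerivAt_id s).add_const c).log (by simp; positivity)
    have h2 := ((hasDerivAt_id s).const_add 1).log (by simp; positivity)
    convert! (h1.sub h2).const_mul c using 1
    simp only [id]
    ring
  · refine Tendsto.const_mul c ?_
    have h1 : Tendsto (fun s : ℝ => 1 + (c - 1) * (1 + s)⁻¹) atTop (𝓝 (1 + (c - 1) * 0)) :=
      ((tendsto_inv_atTop_zero.comp
        (tendsto_atTop_add_const_left _ 1 tendsto_id)).const_mul _).const_add _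
    rw [mul_zero, add_zero] at h1
    have h2 := (Real.continuousAt_log one_ne_zero).tendsto.comp h1
    rw [Real.log_one] at h2
    refine h2.congr' ?_
    filter_upwards [eventually_gt_atTop 0] with s hs
    rw [← Real.log_div (by positivity) (by positivity), Function.comp_apply]
    congr 1
    field_simp
    ring

/-- The integrand lies between the scalar kernel of the total mass and the sum of the scalar kernels
of the entries. The bound depends on x only through M, which makes it a local dominating function.
-/
theorem abs_subentropyIntegrand_le {n : ℕ} {x : Fin n → ℝ} (hx : ∀ i, 0 ≤ x i) {M : ℝ}
    (hxM : ∑ i, x i ≤ M) (hM : 1 ≤ M) {s : ℝ} (hs : 0 < s) :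
    |subentropyIntegrand x s| ≤ (n + 1) * ((1 + M) * M * (1 / (1 + s) ^ 2)) := by
  set B := (1 + M) * M * (1 / (1 + s) ^ 2)
  have hsum : 0 ≤ ∑ i, x i := Finset.sum_nonneg fun i _ => hx i
  have h1 := (abs_le.1 (abs_div_add_sub_div_le hsum hxM hM hs)).1
  have hB : 0 ≤ B := (abs_nonneg _).trans (abs_div_add_sub_div_le hsum hxM hM hs)
  have h2 : ∑ i, (x i / (s + x i) - x i / (1 + s)) ≤ ∑ _i : Fin n, B :=
    Finset.sum_le_sum fun i _ => (abs_le.1 (abs_div_add_sub_div_le (hx i)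
      ((Finset.single_le_sum (fun j _ => hx j) (Finset.mem_univ i)).trans hxM) hM hs)).2
  rw [Finset.sum_sub_distrib, ← Finset.sum_div, Finset.sum_const, Finset.card_univ,
    Fintype.card_fin, nsmul_eq_mul] at h2
  have h3 := prod_div_add_le hx hs
  have h4 := one_sub_sum_le_prod_div_add hx hs
  have h5 : s / (s + ∑ i, x i) = 1 - (∑ i, x i) / (s + ∑ i, x i) := by field_simp; ring
  have h6 : 0 ≤ n * B := by positivity
  unfold subentropyIntegrand
  exact abs_le.2 ⟨by linarith, by linarith⟩

theorem measurable_subentropyIntegrand {n : ℕ} (x : Fin n → ℝ) :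
    Measurable (subentropyIntegrand x) := by
  unfold subentropyIntegrand
  fun_prop

theorem integrableOn_subentropyIntegrand {n : ℕ} {x : Fin n → ℝ} (hx : ∀ i, 0 ≤ x i) :
    IntegrableOn (subentropyIntegrand x) (Ioi 0) := by
  have hsum : 0 ≤ ∑ i, x i := Finset.sum_nonneg fun i _ => hx i
  refine Integrable.mono' ((integrableOn_one_div_one_add_sq.const_mul
    ((1 + (1 + ∑ i, x i)) * (1 + ∑ i, x i))).const_mul (n + 1))
    (measurable_subentropyIntegrand x).aestronglyMeasurable ?_
  refine (ae_restrict_mem measurableSet_Ioi).mono fun s hs => ?_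
  exact abs_subentropyIntegrand_le hx (by linarith) (by linarith) hs

theorem continuousOn_subentropyIntegral {n : ℕ} :
    ContinuousOn (subentropyIntegral (n := n)) {x | ∀ i, 0 ≤ x i} := by
  intro y hy
  have hsum : 0 ≤ ∑ i, y i := Finset.sum_nonneg fun i _ => hy i
  set M := 1 + ∑ i, y i
  refine continuousWithinAt_of_dominated
    (bound := fun s => (n + 1) * ((1 + M) * M * (1 / (1 + s) ^ 2)))
    (Eventually.of_forall fun x => (measurable_subentropyIntegrand x).aestronglyMeasurable) ?_
    ((integrableOn_one_div_one_add_sq.const_mul _).const_mul _) ?_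
  · have hev : ∀ᶠ x : Fin n → ℝ in 𝓝[{x | ∀ i, 0 ≤ x i}] y, ∑ i, x i < M := by
      refine nhdsWithin_le_nhds (ContinuousAt.eventually_lt (f := fun x : Fin n → ℝ => ∑ i, x i)
        (g := fun _ => M) (Continuous.continuousAt (by fun_prop)) continuousAt_const ?_)
      linarith
    filter_upwards [hev, self_mem_nhdsWithin] with x hxM hx
    refine (ae_restrict_mem measurableSet_Ioi).mono fun s hs => ?_
    exact abs_subentropyIntegrand_le hx hxM.le (by linarith) hs
  · refine (ae_restrict_mem measurableSet_Ioi).mono fun s hs => ?_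
    have hs : 0 < s := hs
    refine ContinuousAt.continuousWithinAt ?_
    unfold subentropyIntegrand
    refine ContinuousAt.sub (continuousAt_const.sub (tendsto_finsetProd _ fun i _ => ?_))
      (Continuous.continuousAt (by fun_prop))
    refine ContinuousAt.div continuousAt_const (Continuous.continuousAt (by fun_prop)) ?_
    have := hy i
    positivity

/-! ### Lagrange interpolation: the integral equals the defining expression -/

theorem prod_univ_erase_eq_prod_ite {ι : Type*} [Fintype ι] [DecidableEq ι] (f : ι → ℝ) (i : ι) :
    ∏ j ∈ Finset.univ.erase i, f j = ∏ j, if j = i then 1 else f j := by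
  rw [← Finset.prod_erase (a := i) (f := fun j => if j = i then 1 else f j) _ (by simp)]
  exact Finset.prod_congr rfl fun j hj => by rw [if_neg (Finset.ne_of_mem_erase hj)]

/-- X^n and X^n - ∏ (X - x_i) agree at the nodes; the latter has degree below n and its coefficient
at X^(n-1) is ∑ x_i. -/
theorem sum_pow_div_prod_sub {n : ℕ} {x : Fin n → ℝ} (hx : Function.Injective x) :
    ∑ i, x i ^ n / ∏ j ∈ Finset.univ.erase i, (x i - x j) = ∑ i, x i := by
  rcases Nat.eq_zero_or_pos n with rfl | hn
  · simp
  have hm : (∏ i, (Polynomial.X - Polynomial.C (x i))).Monic :=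
    Polynomial.monic_prod_of_monic _ _ fun i _ => Polynomial.monic_X_sub_C _
  have hd : (∏ i, (Polynomial.X - Polynomial.C (x i))).degree = (n : WithBot ℕ) := by
    rw [Polynomial.degree_prod]; simp
  have hdeg : (Polynomial.X ^ n - ∏ i, (Polynomial.X - Polynomial.C (x i))).degree < (n : WithBot ℕ) := by
    have := Polynomial.degree_sub_lt_left (p := (Polynomial.X : Polynomial ℝ) ^ n)
      (q := ∏ i, (Polynomial.X - Polynomial.C (x i))) (by rw [hd]; simp) (by simp)
      (by rw [hm.leadingCoeff]; simp)
    simpa using this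
  have h := Lagrange.coeff_eq_sum (s := Finset.univ) (v := x) hx.injOn
    (P := Polynomial.X ^ n - ∏ i, (Polynomial.X - Polynomial.C (x i))) (by simpa using hdeg)
  rw [Polynomial.coeff_sub, Polynomial.prod_X_sub_C_coeff_card_pred _ _ (by simpa using hn),
    Polynomial.coeff_X_pow, if_neg (by simp; omega)] at h
  rw [zero_sub, neg_neg] at h
  rw [h]
  refine Finset.sum_congr rfl fun i _ => ?_
  have : ∏ j, (x i - x j) = 0 := Finset.prod_eq_zero (Finset.mem_univ i) (sub_self _)
  simp [Polynomial.eval_prod, this]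

/-- Interpolate X^n at the n+1 nodes -s, x_1, ..., x_n: its leading coefficient is 1, and the node
-s contributes ∏ s/(s + x_i). -/
theorem sum_pow_div_prod_sub_div_add {n : ℕ} {x : Fin n → ℝ} (hx : x ∈ genericVectors n) {s : ℝ}
    (hs : 0 < s) :
    ∑ i, x i ^ n / (∏ j ∈ Finset.univ.erase i, (x i - x j)) / (s + x i) =
      1 - ∏ i, s / (s + x i) := by
  have hv : Function.Injective (Fin.cons (-s) x : Fin (n + 1) → ℝ) := by
    rw [Fin.cons_injective_iff]
    refine ⟨?_, hx.2⟩
    rintro ⟨i, hi⟩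
    linarith [hx.1 i]
  have h := Lagrange.coeff_eq_sum (s := Finset.univ) hv.injOn
    (P := Polynomial.X ^ n) (by simp; exact_mod_cast Nat.lt_succ_self n)
  simp only [prod_univ_erase_eq_prod_ite, Finset.card_univ, Fintype.card_fin, Nat.add_sub_cancel,
    Polynomial.coeff_X_pow_self, Polynomial.eval_pow, Polynomial.eval_X, Fin.sum_univ_succ,
    Fin.prod_univ_succ, Fin.cons_zero, Fin.cons_succ, if_true, Fin.succ_ne_zero, if_false, one_mul,
    (Fin.succ_ne_zero _).symm, Fin.succ_inj] at h
  have h0 : (-s) ^ n / ∏ j, (-s - x j) = ∏ j, s / (s + x j) := by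
    have : (-s) ^ n = ∏ _j : Fin n, (-s) := by simp
    rw [this, ← Finset.prod_div_distrib]
    refine Finset.prod_congr rfl fun j _ => ?_
    rw [← neg_add', neg_div_neg_eq]
  rw [h0] at h
  rw [eq_sub_iff_add_eq', h]
  congr 1
  refine Finset.sum_congr rfl fun i _ => ?_
  rw [prod_univ_erase_eq_prod_ite, div_div]
  congr 1
  ring

theorem subentropyIntegral_eq_subentropyExpr {n : ℕ} {x : Fin n → ℝ} (hx : x ∈ genericVectors n) :
    subentropyIntegral x = subentropyExpr x := by
  set w : Fin n → ℝ := fun i => x i ^ n / ∏ j ∈ Finset.univ.erase i, (x i - x j) with hw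
  have h1 : subentropyIntegral x =
      ∫ s in Ioi (0 : ℝ), ∑ i, w i / x i * (x i / (s + x i) - x i / (1 + s)) := by
    refine setIntegral_congr_fun measurableSet_Ioi fun s hs => ?_
    have hs : 0 < s := hs
    rw [subentropyIntegrand, ← sum_pow_div_prod_sub_div_add hx hs, ← sum_pow_div_prod_sub hx.2,
      Finset.sum_div, ← Finset.sum_sub_distrib]
    refine Finset.sum_congr rfl fun i _ => ?_
    have := hx.1 i
    show w i / (s + x i) - w i / (1 + s) = _
    field_simp
  rw [h1, integral_finsetSum _ fun i _ =>
    (integrableOn_div_add_sub_div (hx.1 i).le).const_mul _, subentropyExpr,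
    ← Finset.sum_neg_distrib]
  refine Finset.sum_congr rfl fun i _ => ?_
  rw [integral_const_mul, integral_div_add_sub_div (hx.1 i).le, Real.negMulLog]
  have := (hx.1 i).ne'
  show w i / x i * (-x i * Real.log (x i)) = -(w i * Real.log (x i))
  field_simp

theorem tendsto_subentropyExpr {n : ℕ} {x : Fin n → ℝ} (hx : ∀ i, 0 ≤ x i) :
    Tendsto subentropyExpr (𝓝[genericVectors n] x) (𝓝 (subentropyIntegral x)) := by
  have h : Tendsto subentropyIntegral (𝓝[genericVectors n] x) (𝓝 (subentropyIntegral x)) :=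
    (continuousOn_subentropyIntegral x hx).mono fun y hy i => (hy.1 i).le
  refine h.congr' ?_
  filter_upwards [self_mem_nhdsWithin] with y hy
  exact subentropyIntegral_eq_subentropyExpr hy

theorem subentropyFun_eq_subentropyIntegral {n : ℕ} {x : Fin n → ℝ} (hx : ∀ i, 0 ≤ x i)
    (hanti : Antitone x) : subentropyFun x = subentropyIntegral x :=
  have := neBot_nhdsWithin_genericVectors hx hanti
  (tendsto_subentropyExpr hx).limUnder_eq

/-! ### Subadditivity, entropy bound, scaling and concavity -/

/-- With P and R the products for a and b, the product for a + b is at least PR, and 1 - PR ≤ (1 -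
P) + (1 - R). -/
theorem subentropyIntegral_add_le {n : ℕ} {a b : Fin n → ℝ} (ha : ∀ i, 0 ≤ a i)
    (hb : ∀ i, 0 ≤ b i) :
    subentropyIntegral (a + b) ≤ subentropyIntegral a + subentropyIntegral b := by
  have hab : ∀ i, 0 ≤ (a + b) i := fun i => add_nonneg (ha i) (hb i)
  unfold subentropyIntegral
  rw [← integral_add (integrableOn_subentropyIntegrand ha) (integrableOn_subentropyIntegrand hb)]
  refine setIntegral_mono_on (integrableOn_subentropyIntegrand hab)
    ((integrableOn_subentropyIntegrand ha).add (integrableOn_subentropyIntegrand hb))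
    measurableSet_Ioi fun s hs => ?_
  have hs : 0 < s := hs
  have h : (∏ i, s / (s + a i)) * ∏ i, s / (s + b i) ≤ ∏ i, s / (s + (a + b) i) := by
    rw [← Finset.prod_mul_distrib]
    refine Finset.prod_le_prod (fun i _ => ?_) fun i _ => ?_
    · have := ha i; have := hb i; positivity
    · have h1 := ha i
      have h2 := hb i
      rw [Pi.add_apply, div_mul_div_comm, div_le_div_iff₀ (by positivity) (by positivity)]
      nlinarith [mul_nonneg (mul_nonneg hs.le h1) h2]
  have h1 := prod_div_add_le_one ha hs
  have h2 := prod_div_add_le_one hb hs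
  simp only [subentropyIntegrand, Pi.add_apply, Finset.sum_add_distrib, add_div] at h ⊢
  nlinarith [mul_nonneg (sub_nonneg.2 h1) (sub_nonneg.2 h2)]

/-- The subentropy is at most the entropy. -/
theorem subentropyIntegral_le_sum_negMulLog {n : ℕ} {x : Fin n → ℝ} (hx : ∀ i, 0 ≤ x i) :
    subentropyIntegral x ≤ ∑ i, Real.negMulLog (x i) := by
  have hint : ∀ i ∈ Finset.univ, IntegrableOn (fun s => x i / (s + x i) - x i / (1 + s))
      (Ioi (0 : ℝ)) := fun i _ => integrableOn_div_add_sub_div (hx i)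
  calc subentropyIntegral x
      ≤ ∫ s in Ioi (0 : ℝ), ∑ i, (x i / (s + x i) - x i / (1 + s)) := by
        refine setIntegral_mono_on (integrableOn_subentropyIntegrand hx)
          (integrable_finsetSum _ hint) measurableSet_Ioi fun s hs => ?_
        have := one_sub_sum_le_prod_div_add hx hs
        rw [Finset.sum_sub_distrib, ← Finset.sum_div, subentropyIntegrand]
        linarith
    _ = ∑ i, Real.negMulLog (x i) := by
        rw [integral_finsetSum _ hint]
        exact Finset.sum_congr rfl fun i _ => integral_div_add_sub_div (hx i)

theorem subentropyIntegral_nonneg {n : ℕ} {x : Fin n → ℝ} (hx : ∀ i, 0 ≤ x i)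
    (h1 : ∑ i, x i = 1) : 0 ≤ subentropyIntegral x := by
  refine setIntegral_nonneg measurableSet_Ioi fun s hs => ?_
  have hs : 0 < s := hs
  have h := prod_div_add_le hx hs
  rw [h1] at h
  have e : s / (s + 1) = 1 - 1 / (1 + s) := by field_simp; ring
  rw [subentropyIntegrand, h1]
  linarith

/-- Substituting s ↦ cs leaves the product unchanged; only the normalising term moves, by a scalar
kernel with parameter c⁻¹. -/
theorem subentropyIntegral_smul {n : ℕ} {x : Fin n → ℝ} (hx : ∀ i, 0 ≤ x i) {c : ℝ} (hc : 0 < c) :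
    subentropyIntegral (c • x) = c * subentropyIntegral x + (∑ i, x i) * Real.negMulLog c := by
  have h := integral_comp_mul_left_Ioi' (subentropyIntegrand (c • x)) 0 hc
  rw [mul_zero] at h
  have h1 : ∫ s in Ioi (0 : ℝ), subentropyIntegrand (c • x) (c * s) =
      ∫ s in Ioi (0 : ℝ), (subentropyIntegrand x s +
        (-(c * ∑ i, x i)) * (c⁻¹ / (s + c⁻¹) - c⁻¹ / (1 + s))) := by
    refine setIntegral_congr_fun measurableSet_Ioi fun s hs => ?_
    have hs : 0 < s := hs
    have e : ∀ i, c * s / (c * s + (c • x) i) = s / (s + x i) := fun i => by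
      rw [Pi.smul_apply, smul_eq_mul, ← mul_add, mul_div_mul_left _ _ hc.ne']
    have e2 : ∑ i, (c • x) i = c * ∑ i, x i := by simp [Finset.mul_sum]
    simp only [subentropyIntegrand, e, e2]
    field_simp
    ring
  rw [h1, integral_add (integrableOn_subentropyIntegrand hx)
    ((integrableOn_div_add_sub_div (by positivity)).const_mul _), integral_const_mul,
    integral_div_add_sub_div (by positivity)] at h
  unfold subentropyIntegral
  rw [← h, smul_eq_mul, Real.negMulLog, Real.negMulLog, Real.log_inv]
  field_simp

/-- Each factor is log-convex in its entry, so the product is log-convex and hence convex. AM-GM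
enters twice: in the denominators and between the two products. -/
theorem prod_div_add_convex {n : ℕ} {x y : Fin n → ℝ} (hx : ∀ i, 0 ≤ x i) (hy : ∀ i, 0 ≤ y i)
    {p q : ℝ} (hp : 0 ≤ p) (hq : 0 ≤ q) (hpq : p + q = 1) {s : ℝ} (hs : 0 < s) :
    ∏ i, s / (s + (p • x + q • y) i) ≤ p * ∏ i, s / (s + x i) + q * ∏ i, s / (s + y i) := by
  refine le_trans ?_ (Real.geom_mean_le_arith_mean2_weighted hp hq (prod_div_add_nonneg hx hs)
    (prod_div_add_nonneg hy hs) hpq)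
  rw [← Real.finsetProd_rpow _ _ fun i _ => by have := hx i; positivity,
    ← Real.finsetProd_rpow _ _ fun i _ => by have := hy i; positivity, ← Finset.prod_mul_distrib]
  refine Finset.prod_le_prod (fun i _ => ?_) fun i _ => ?_
  · have := hx i; have := hy i
    simp only [Pi.add_apply, Pi.smul_apply, smul_eq_mul]
    positivity
  · have h1 : 0 < s + x i := by have := hx i; positivity
    have h2 : 0 < s + y i := by have := hy i; positivity
    have h := Real.geom_mean_le_arith_mean2_weighted hp hq h1.le h2.le hpq
    have e : s + (p • x + q • y) i = p * (s + x i) + q * (s + y i) := by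
      simp only [Pi.add_apply, Pi.smul_apply, smul_eq_mul]
      linear_combination (-s) * hpq
    have e2 : s ^ p * s ^ q = s := by rw [← Real.rpow_add hs, hpq, Real.rpow_one]
    rw [e, Real.div_rpow hs.le h1.le, Real.div_rpow hs.le h2.le, div_mul_div_comm, e2]
    gcongr

theorem subentropyIntegral_concave {n : ℕ} {x y : Fin n → ℝ} (hx : ∀ i, 0 ≤ x i)
    (hy : ∀ i, 0 ≤ y i) {p q : ℝ} (hp : 0 ≤ p) (hq : 0 ≤ q) (hpq : p + q = 1) :
    p * subentropyIntegral x + q * subentropyIntegral y ≤ subentropyIntegral (p • x + q • y) := by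
  have hxy : ∀ i, 0 ≤ (p • x + q • y) i := fun i =>
    add_nonneg (mul_nonneg hp (hx i)) (mul_nonneg hq (hy i))
  have ix := (integrableOn_subentropyIntegrand hx).const_mul p
  have iy := (integrableOn_subentropyIntegrand hy).const_mul q
  unfold subentropyIntegral
  rw [← integral_const_mul, ← integral_const_mul, ← integral_add ix iy]
  refine setIntegral_mono_on (ix.add iy) (integrableOn_subentropyIntegrand hxy) measurableSet_Ioi
    fun s hs => ?_
  have h := prod_div_add_convex hx hy hp hq hpq hs
  have e : ∑ i, (p • x + q • y) i = p * ∑ i, x i + q * ∑ i, y i := by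
    simp [Finset.mul_sum, Finset.sum_add_distrib]
  rw [subentropyIntegrand, subentropyIntegrand, subentropyIntegrand, e, add_div, mul_div_assoc,
    mul_div_assoc]
  linear_combination h + hpq

/-! ### Continuity bound for probability vectors -/

/-- Completing a subnormalised vector to a probability vector costs at most `- c * log c`, where
`c` is its mass. -/
theorem subentropyIntegral_le_add_negMulLog {n : ℕ} {x b : Fin n → ℝ} (hx : ∀ i, 0 ≤ x i)
    (hb : ∀ i, 0 ≤ b i) {t : ℝ} (ht1 : t < 1) (hxt : ∑ i, x i = 1 - t) (hbt : ∑ i, b i = t) :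
    subentropyIntegral x ≤ subentropyIntegral (x + b) + Real.negMulLog (1 - t) := by
  have ht0 : 0 ≤ t := hbt ▸ Finset.sum_nonneg fun i _ => hb i
  rcases ht0.eq_or_lt with rfl | ht0
  · have hb0 : b = 0 := funext fun i =>
      (Finset.sum_eq_zero_iff_of_nonneg fun i _ => hb i).1 hbt i (Finset.mem_univ i)
    simp [hb0]
  have hc : 0 < 1 - t := by linarith
  have hx' : ∀ i, 0 ≤ ((1 - t)⁻¹ • x) i := fun i => mul_nonneg (by positivity) (hx i)
  have hb' : ∀ i, 0 ≤ (t⁻¹ • b) i := fun i => mul_nonneg (by positivity) (hb i)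
  have hx1 : ∑ i, ((1 - t)⁻¹ • x) i = 1 := by
    simp [← Finset.mul_sum, hxt, hc.ne']
  have hb1 : ∑ i, (t⁻¹ • b) i = 1 := by
    simp [← Finset.mul_sum, hbt, ht0.ne']
  -- Here x + b is the mixture of the normalised x and b with weights 1 - t and t; the b term is
  -- nonnegative and is dropped.
  have h1 := subentropyIntegral_concave hx' hb' hc.le ht0.le (by ring)
  have h2 := subentropyIntegral_smul hx' hc
  have h3 := mul_nonneg ht0.le (subentropyIntegral_nonneg hb' hb1)
  rw [smul_inv_smul₀ hc.ne', smul_inv_smul₀ ht0.ne'] at h1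
  rw [smul_inv_smul₀ hc.ne', hx1, one_mul] at h2
  linarith

/-- The entropy of a vector of mass `t` with a vanishing entry. -/
theorem sum_negMulLog_le_of_apply_eq_zero {n : ℕ} {a : Fin n → ℝ} (ha : ∀ i, 0 ≤ a i) {k : Fin n}
    (hk : a k = 0) :
    ∑ i, Real.negMulLog (a i) ≤
      (∑ i, a i) * Real.log ((n : ℝ) - 1) + Real.negMulLog (∑ i, a i) := by
  have hcard : ((Finset.univ.erase k).card : ℝ) = (n : ℝ) - 1 := by
    rw [Finset.card_erase_of_mem (Finset.mem_univ k), Finset.card_univ, Fintype.card_fin,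
      Nat.cast_pred k.pos]
  have e1 : ∑ i ∈ Finset.univ.erase k, a i = ∑ i, a i := Finset.sum_erase _ hk
  have e2 : ∑ i ∈ Finset.univ.erase k, Real.negMulLog (a i) = ∑ i, Real.negMulLog (a i) :=
    Finset.sum_erase _ (by simp [hk])
  rcases (Finset.univ.erase k).eq_empty_or_nonempty with he | he
  · rw [← e1, ← e2, he]
    simp
  have hm : (0 : ℝ) < (n : ℝ) - 1 := hcard ▸ Nat.cast_pos.2 he.card_pos
  -- Jensen with uniform weights on the n - 1 indices other than k.
  have h := Real.concaveOn_negMulLog.le_map_sum (t := Finset.univ.erase k)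
    (w := fun _ => ((n : ℝ) - 1)⁻¹) (p := a) (fun _ _ => by positivity)
    (by rw [Finset.sum_const, nsmul_eq_mul, hcard, mul_inv_cancel₀ hm.ne']) (fun i _ => ha i)
  simp only [smul_eq_mul, ← Finset.mul_sum, e1, e2] at h
  rw [Real.negMulLog_mul, inv_mul_le_iff₀ hm] at h
  refine h.trans (le_of_eq ?_)
  rw [Real.negMulLog, Real.log_inv]
  field_simp

/-- The sharp continuity bound for probability vectors. -/
theorem subentropyIntegral_sub_le {n : ℕ} {x y : Fin n → ℝ} (hx : ∀ i, 0 ≤ x i)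
    (hy : ∀ i, 0 ≤ y i) (hx1 : ∑ i, x i = 1) (hy1 : ∑ i, y i = 1) {t : ℝ}
    (ht : ∑ i, |x i - y i| = 2 * t) (ht1 : t < 1) :
    subentropyIntegral x - subentropyIntegral y ≤
      t * Real.log ((n : ℝ) - 1) + Real.binEntropy t := by
  set a : Fin n → ℝ := fun i => max (x i - y i) 0 with ha
  set b : Fin n → ℝ := fun i => max (y i - x i) 0 with hb
  set z : Fin n → ℝ := fun i => min (x i) (y i) with hz
  have ha0 : ∀ i, 0 ≤ a i := fun i => le_max_right _ _
  have hb0 : ∀ i, 0 ≤ b i := fun i => le_max_right _ _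
  have hz0 : ∀ i, 0 ≤ z i := fun i => le_min (hx i) (hy i)
  have hxz : x = z + a := funext fun i => by simp only [ha, hz, Pi.add_apply]; grind
  have hyz : y = z + b := funext fun i => by simp only [hb, hz, Pi.add_apply]; grind
  have hsum : (∑ i, a i) + ∑ i, b i = 2 * t := by
    rw [← ht, ← Finset.sum_add_distrib]
    exact Finset.sum_congr rfl fun i _ => by simp only [ha, hb]; grind
  have hxs : (∑ i, z i) + ∑ i, a i = 1 := by
    rw [← hx1, ← Finset.sum_add_distrib]
    exact Finset.sum_congr rfl fun i _ => (congrFun hxz i).symm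
  have hys : (∑ i, z i) + ∑ i, b i = 1 := by
    rw [← hy1, ← Finset.sum_add_distrib]
    exact Finset.sum_congr rfl fun i _ => (congrFun hyz i).symm
  have hat : ∑ i, a i = t := by linarith
  -- Equal total mass rules out x > y everywhere, so a vanishes at some k; this is why n - 1 appears
  -- instead of n.
  obtain ⟨k, hk⟩ : ∃ k, x k ≤ y k := by
    by_contra! h
    have hne : (Finset.univ : Finset (Fin n)).Nonempty := by
      rw [Finset.nonempty_iff_ne_empty]
      intro h0
      rw [h0] at hx1
      simp at hx1
    have := Finset.sum_lt_sum_of_nonempty hne fun i _ => h i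
    linarith
  have h1 := subentropyIntegral_add_le hz0 ha0
  have h2 := subentropyIntegral_le_sum_negMulLog ha0
  have h3 := sum_negMulLog_le_of_apply_eq_zero ha0 (k := k) (max_eq_right (by linarith))
  have h4 := subentropyIntegral_le_add_negMulLog hz0 hb0 ht1 (by linarith) (by linarith)
  rw [← hxz] at h1
  rw [← hyz] at h4
  rw [hat] at h3
  rw [Real.binEntropy_eq_negMulLog_add_negMulLog_one_sub]
  linarith

theorem abs_subentropyIntegral_sub_le {n : ℕ} {x y : Fin n → ℝ} (hx : ∀ i, 0 ≤ x i)
    (hy : ∀ i, 0 ≤ y i) (hx1 : ∑ i, x i = 1) (hy1 : ∑ i, y i = 1) {t : ℝ}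
    (ht : ∑ i, |x i - y i| = 2 * t) (ht1 : t < 1) :
    |subentropyIntegral x - subentropyIntegral y| ≤
      t * Real.log ((n : ℝ) - 1) + Real.binEntropy t := by
  refine abs_sub_le_iff.2 ⟨subentropyIntegral_sub_le hx hy hx1 hy1 ht ht1,
    subentropyIntegral_sub_le hy hx hy1 hx1 ?_ ht1⟩
  rw [← ht]
  exact Finset.sum_congr rfl fun i _ => abs_sub_comm _ _

/-- Since η(2T) = 2η(T) - 2T ln 2, it suffices that η(1-T) ≤ T ≤ η(T), the latter because T ≤ 1/e,
and that 4(n-1) ≤ n². -/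
theorem mul_log_add_binEntropy_le {n : ℕ} (hn : 2 ≤ n) {T : ℝ} (hT0 : 0 ≤ T)
    (hT : T ≤ 1 / (2 * Real.exp 1)) :
    T * Real.log ((n : ℝ) - 1) + Real.binEntropy T ≤
      2 * T * Real.log n + Real.negMulLog (2 * T) := by
  have hn' : (2 : ℝ) ≤ n := by exact_mod_cast hn
  have h1 : Real.negMulLog (1 - T) ≤ T := by
    have hT1 : T ≤ 1 := hT.trans (by
      rw [div_le_one (by positivity)]
      linarith [Real.add_one_le_exp 1])
    linarith [Real.negMulLog_le_one_sub_self (x := 1 - T) (by linarith)]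
  have h2 : T ≤ Real.negMulLog T := by
    rcases hT0.eq_or_lt with rfl | hT0
    · simp
    have hle : T ≤ Real.exp (-1) := hT.trans (by
      rw [Real.exp_neg, ← one_div]
      exact one_div_le_one_div_of_le (Real.exp_pos 1) (by linarith [Real.exp_pos 1]))
    have := (Real.log_le_iff_le_exp hT0).2 hle
    rw [Real.negMulLog]
    nlinarith
  have h3 : Real.log ((n : ℝ) - 1) + 2 * Real.log 2 ≤ 2 * Real.log n := by
    have e2 : 2 * Real.log 2 = Real.log (2 ^ 2) := by rw [Real.log_pow]; norm_num
    have en : 2 * Real.log n = Real.log ((n : ℝ) ^ 2) := by rw [Real.log_pow]; norm_num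
    rw [e2, en, ← Real.log_mul (by linarith) (by norm_num)]
    exact Real.log_le_log (by nlinarith) (by nlinarith [sq_nonneg ((n : ℝ) - 2)])
  have e : Real.negMulLog (2 * T) = 2 * Real.negMulLog T - 2 * T * Real.log 2 := by
    rw [Real.negMulLog_mul, Real.negMulLog, Real.negMulLog]
    ring
  rw [e, Real.binEntropy_eq_negMulLog_add_negMulLog_one_sub]
  nlinarith [mul_le_mul_of_nonneg_left h3 hT0]

/-! ### Transfer to states -/

theorem QState.subentropy_eq {H : Type*} [NormedAddCommGroup H] [InnerProductSpace ℂ H]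
    [FiniteDimensional ℂ H] (ρ : QState H) : subentropy ρ = subentropyIntegral ρ.eigenvalues :=
  subentropyFun_eq_subentropyIntegral ρ.eigenvalues_nonneg
    (ρ.pos.isSymmetric.eigenvalues_antitone rfl)

theorem QState.tendsto_subentropy {H : Type*} [NormedAddCommGroup H] [InnerProductSpace ℂ H]
    [FiniteDimensional ℂ H] (ρ : QState H) :
    Tendsto subentropyExpr (𝓝[genericVectors (finrank ℂ H)] ρ.eigenvalues)
      (𝓝 (subentropy ρ)) := by
  rw [ρ.subentropy_eq]
  exact tendsto_subentropyExpr ρ.eigenvalues_nonneg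

theorem QState.finrank_pos {H : Type*} [NormedAddCommGroup H] [InnerProductSpace ℂ H]
    [FiniteDimensional ℂ H] (ρ : QState H) : 0 < finrank ℂ H := by
  by_contra h
  have hsub : IsEmpty (Fin (finrank ℂ H)) := by rw [Nat.eq_zero_of_not_pos h]; infer_instance
  simpa using ρ.sum_eigenvalues

/-- In dimension one all states have the same eigenvalues. -/
theorem QState.eigenvalues_eq_of_finrank_eq_one {H : Type*} [NormedAddCommGroup H]
    [InnerProductSpace ℂ H] [FiniteDimensional ℂ H] (h : finrank ℂ H = 1) (ρ σ : QState H) :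
    ρ.eigenvalues = σ.eigenvalues := by
  have hsub : Subsingleton (Fin (finrank ℂ H)) := by rw [h]; infer_instance
  funext i
  have h1 := ρ.sum_eigenvalues
  have h2 := σ.sum_eigenvalues
  rw [Fintype.sum_subsingleton _ i] at h1 h2
  rw [h1, h2]

end

theorem mainTheorem6 {H : Type*} [NormedAddCommGroup H] [InnerProductSpace ℂ H]
    [FiniteDimensional ℂ H] (n : ℕ) (hn : finrank ℂ H = n) (ρ σ : QState H) (T : ℝ)
    (hT : traceDist ρ σ = T) (hTle : T ≤ 1 / (2 * Real.exp 1)) :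
    (Tendsto subentropyExpr (𝓝[genericVectors (finrank ℂ H)] ρ.eigenvalues)
        (𝓝 (subentropy ρ)) ∧
      Tendsto subentropyExpr (𝓝[genericVectors (finrank ℂ H)] σ.eigenvalues)
        (𝓝 (subentropy σ))) ∧
    |subentropy ρ - subentropy σ| ≤ 2 * T * Real.log n + Real.negMulLog (2 * T) ∧
    |subentropy ρ - subentropy σ| ≤ T * Real.log ((n : ℝ) - 1) + Real.binEntropy T := by
  refine ⟨⟨ρ.tendsto_subentropy, σ.tendsto_subentropy⟩, ?_⟩
  have hle := sum_abs_eigenvalues_sub_le ρ σ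
  have hn1 : 1 ≤ n := hn ▸ ρ.finrank_pos
  -- The vector bound holds at the spectral distance t ≤ T; both of its terms are then enlarged to
  -- T.
  obtain ⟨t, ht⟩ : ∃ t, ∑ i, |ρ.eigenvalues i - σ.eigenvalues i| = 2 * t :=
    ⟨(∑ i, |ρ.eigenvalues i - σ.eigenvalues i|) / 2, by ring⟩
  have ht0 : 0 ≤ 2 * t := ht ▸ Finset.sum_nonneg fun i _ => abs_nonneg _
  rw [ht, hT] at hle
  have hT2 : T ≤ 2⁻¹ := hTle.trans (by
    rw [one_div]
    exact inv_anti₀ two_pos (by linarith [Real.add_one_le_exp 1]))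
  -- For n = 1 this rests on the default value `Real.log 0 = 0`.
  have hlog : 0 ≤ Real.log ((n : ℝ) - 1) := by
    have h := Real.log_natCast_nonneg (n - 1)
    rwa [Nat.cast_pred hn1] at h
  have hsharp : |subentropy ρ - subentropy σ| ≤
      T * Real.log ((n : ℝ) - 1) + Real.binEntropy T := by
    have h := abs_subentropyIntegral_sub_le ρ.eigenvalues_nonneg σ.eigenvalues_nonneg
      ρ.sum_eigenvalues σ.sum_eigenvalues ht (by linarith)
    rw [show (finrank ℂ H : ℝ) = n from congrArg Nat.cast hn] at h
    rw [ρ.subentropy_eq, σ.subentropy_eq]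
    refine h.trans (add_le_add (mul_le_mul_of_nonneg_right (by linarith) hlog) ?_)
    exact Real.binEntropy_strictMonoOn.monotoneOn ⟨by linarith, by linarith⟩
      ⟨by linarith, hT2⟩ (by linarith)
  refine ⟨?_, hsharp⟩
  -- The comparison of the two bounds needs n ≥ 2; for n = 1 the spectra coincide and the left side
  -- is 0.
  rcases hn1.eq_or_lt with h1 | h2
  · rw [ρ.subentropy_eq, σ.subentropy_eq,
      QState.eigenvalues_eq_of_finrank_eq_one (hn.trans h1.symm) ρ σ, sub_self, abs_zero, ← h1]
    have := Real.negMulLog_nonneg (x := 2 * T) (by linarith) (by linarith)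
    simpa using this
  · exact hsharp.trans (mul_log_add_binEntropy_le h2 (by linarith) hTle)
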